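/- Let $(M,g)$ be a closed (compact, connected, without boundary) smooth Riemannian manifold. There is a constant $C_5$, depending only on $(M,g)$, such that for every domain (nonempty connected open set) $\Omega\subseteq M$, $$\lambda_1(\Omega)\le \frac{C_5}{\mathrm{inrad}(\Omega)^2}.$$ Here $\lambda_1(\Omega)$ is the first Dirichlet eigenvalue of the Laplace–Beltrami operator on $\Omega$, with no regularity of $\partial\Omega$ assumed, that is, $$\lambda_1(\Omega)=\inf\left\{\frac{\int_M|\nabla f|_g^2\,d\mathrm{vol}_g}{\int_M f^2\,d\mathrm{vol}_g} : f\in C_c^\infty(\Omega),\ f\neq 0\right\},$$ and $\mathrm{inrad}(\Omega)=\sup\{r\ge 0 : B(p,r)\subseteq\Omega \text{ for some } p\in M\}$ is the inner radius of $\Omega$, where $B(p,r)$ is the open ball for the Riemannian distance. (For $\Omega=M$ this reads $\lambda_1(M)=0$, $\mathrm{inrad}(M)=\infty$, and the right-hand side is $0$.) -/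

import Mathlib

open Set MeasureTheory Manifold Bundle
open scoped ENNReal NNReal ContDiff Topology

noncomputable section

namespace RiemGeom

section Volume

variable {n : ℕ} {M : Type*} [TopologicalSpace M] [ChartedSpace (EuclideanSpace ℝ (Fin n)) M]
  [RiemannianBundle (fun x : M ↦ TangentSpace (𝓡 n) x)]

/-- The coordinate vector field `∂ᵢ` of the chart around `x`, at the point with coordinates `y`. -/
def coordVector (x : M) (y : EuclideanSpace ℝ (Fin n)) (i : Fin n) :
    TangentSpace (𝓡 n) ((extChartAt (𝓡 n) x).symm y) :=
  mfderiv 𝓘(ℝ, EuclideanSpace ℝ (Fin n)) (𝓡 n) (extChartAt (𝓡 n) x).symm y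
    (EuclideanSpace.single i (1 : ℝ))

/-- The matrix `gᵢⱼ(y) = g(∂ᵢ, ∂ⱼ)` of the metric in the chart around `x`, at the point with
coordinates `y`. -/
def metricMatrix (x : M) (y : EuclideanSpace ℝ (Fin n)) : Matrix (Fin n) (Fin n) ℝ :=
  Matrix.of fun i j ↦ inner ℝ (coordVector x y i) (coordVector x y j)

variable [MeasurableSpace M]

/-- The measure `√(det gᵢⱼ) dy` of the chart domain around `x`, as a measure on `M` (zero outside
the chart domain). -/
def chartVolume (x : M) : Measure M :=
  ((volume.restrict (extChartAt (𝓡 n) x).target).withDensity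
    (fun y ↦ ENNReal.ofReal (√(metricMatrix x y).det))).map (extChartAt (𝓡 n) x).symm

variable [T2Space M] [SigmaCompactSpace M] [IsManifold (𝓡 n) ∞ M]

variable (n M) in
/-- A smooth partition of unity subordinate to the domains of the preferred charts. -/
def chartPartition : SmoothPartitionOfUnity M (𝓡 n) M univ :=
  (SmoothPartitionOfUnity.exists_isSubordinate_chartAt_source (𝓡 n) M).choose

variable (n M) in
/-- The Riemannian volume measure `∑ₓ ρₓ √(det gᵢⱼ) dy`, where `(ρₓ)` is a smooth partition of unity
subordinate to the chart domains (the result does not depend on the choice). -/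
def riemVolume : Measure M :=
  Measure.sum fun x : M ↦
    (chartVolume (n := n) x).withDensity fun p ↦ ENNReal.ofReal (chartPartition n M x p)

end Volume

section FirstEigenvalue

variable {n : ℕ} {M : Type*} [TopologicalSpace M] [ChartedSpace (EuclideanSpace ℝ (Fin n)) M]

variable (n) in
/-- `f` is a smooth function with compact support contained in `Ω`. -/
def IsTestFunction (Ω : Set M) (f : M → ℝ) : Prop :=
  ContMDiff (𝓡 n) 𝓘(ℝ, ℝ) ∞ f ∧ HasCompactSupport f ∧ tsupport f ⊆ Ω

variable [RiemannianBundle (fun x : M ↦ TangentSpace (𝓡 n) x)]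

/-- The differential of `f` at `p`, as a linear form on the tangent space. -/
def differential (f : M → ℝ) (p : M) : TangentSpace (𝓡 n) p →L[ℝ] ℝ :=
  mfderiv (𝓡 n) 𝓘(ℝ, ℝ) f p

instance (p : M) : FiniteDimensional ℝ (TangentSpace (𝓡 n) p) :=
  inferInstanceAs (FiniteDimensional ℝ (EuclideanSpace ℝ (Fin n)))

/-- The Riemannian gradient: `g(∇f, v) = df(v)` for all tangent vectors `v` at `p`. -/
def riemGradient (f : M → ℝ) (p : M) : TangentSpace (𝓡 n) p :=
  haveI : CompleteSpace (TangentSpace (𝓡 n) p) := FiniteDimensional.complete ℝ _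
  (InnerProductSpace.toDual ℝ (TangentSpace (𝓡 n) p)).symm (differential f p)

variable [MeasurableSpace M] [T2Space M] [SigmaCompactSpace M] [IsManifold (𝓡 n) ∞ M]

variable (n) in
/-- The Rayleigh quotient `∫ |∇f|² dvol / ∫ f² dvol`. -/
def rayleigh (f : M → ℝ) : ℝ≥0∞ :=
  (∫⁻ p, ‖riemGradient (n := n) f p‖ₑ ^ 2 ∂(riemVolume n M)) / (∫⁻ p, ‖f p‖ₑ ^ 2 ∂(riemVolume n M))

variable (n) in
/-- The first Dirichlet eigenvalue `λ₁(Ω)` of an open set `Ω`, with no regularity of the boundary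
assumed: the infimum of the Rayleigh quotient over the nonzero smooth functions compactly supported
in `Ω` (equivalently, over the nonzero elements of their closure `H¹₀(Ω)`). -/
def lambdaOne (Ω : Set M) : ℝ≥0∞ :=
  ⨅ (f : M → ℝ) (_ : IsTestFunction n Ω f) (_ : f ≠ 0), rayleigh n f

end FirstEigenvalue

/-- The inner radius of `Ω`: the supremum of the radii of the balls contained in `Ω`. -/
def inrad {M : Type*} [MetricSpace M] (Ω : Set M) : ℝ≥0∞ :=
  ⨆ (p : M) (r : ℝ≥0) (_ : Metric.ball p (r : ℝ) ⊆ Ω), (r : ℝ≥0∞)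

end RiemGeom

end

namespace RiemGeom

/-! `λ₁` decreases when the domain grows, so it is enough to bound it on a ball contained in `Ω`.
For a small ball `B(p, r)` the test function is a rescaled Euclidean bump, read in a chart around a
nearby point `z`. If the inverse chart is `K`-Lipschitz, the coordinate ball of radius `s = r /
(2K)` lands inside `B(p, r)`. The gradient of the bump is `O(1/s)`, and the ratio of the volumes of
its support and of the set where it equals `1` is bounded, because near `z` the Riemannian volume
lies between two multiples of coordinate Lebesgue measure (`exists_volume_le_riemVolume`,
`exists_riemVolume_le_volume`). This gives `λ₁ ≤ D / r²` near `z` (`exists_lambdaOne_ball_le_nhds`),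
and compactness makes the constants uniform.

If `Ω ≠ M`, every ball in `Ω` has radius at most `diam M`, so shrinking a large ball to a small one
costs only a constant. The supremum defining the inner radius need not be attained; a ball of more
than half that radius costs a factor `4`. For `Ω = M` constants are test functions. -/

/-- A `K`-Lipschitz map of `ℝⁿ` increases the volume at most by the factor `Kⁿ`. -/
theorem volume_image_le_of_lipschitzOnWith {n : ℕ} {K : ℝ≥0}
    {f : EuclideanSpace ℝ (Fin n) → EuclideanSpace ℝ (Fin n)} {s : Set (EuclideanSpace ℝ (Fin n))}
    (hf : LipschitzOnWith K f s) : volume (f '' s) ≤ (K : ℝ≥0∞) ^ n * volume s := by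
  -- Lebesgue measure is a constant multiple of `n`-dimensional Hausdorff measure, whose growth
  -- under Lipschitz maps is immediate.
  rw [← EuclideanSpace.euclideanHausdorffMeasure_eq_volume,
    Measure.euclideanHausdorffMeasure_def, Measure.smul_apply, Measure.smul_apply,
    ENNReal.smul_def, ENNReal.smul_def, smul_eq_mul, smul_eq_mul, mul_left_comm]
  gcongr
  simpa using hf.hausdorffMeasure_image_le (d := n) (Nat.cast_nonneg n)

/-! ### Chart transitions and the metric matrix in coordinates -/

section Charts

variable {n : ℕ} {M : Type*} [TopologicalSpace M] [ChartedSpace (EuclideanSpace ℝ (Fin n)) M]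
  [IsManifold (𝓡 n) ∞ M]

/-- Near a common point of two chart domains, the coordinate volumes of the two charts are
comparable. -/
theorem exists_volume_image_extChartAt_le {x x' z : M} (hx : z ∈ (extChartAt (𝓡 n) x).source)
    (hx' : z ∈ (extChartAt (𝓡 n) x').source) :
    ∃ K : ℝ≥0, ∃ U ∈ 𝓝 z, ∀ A ⊆ U, volume (extChartAt (𝓡 n) x' '' A) ≤
      (K : ℝ≥0∞) * volume (extChartAt (𝓡 n) x '' A) := by
  -- The transition map is `C¹`, hence locally Lipschitz.
  set τ := extChartAt (𝓡 n) x' ∘ (extChartAt (𝓡 n) x).symm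
  have hτ : ContDiffAt ℝ 1 τ (extChartAt (𝓡 n) x z) := by
    have h := contDiffWithinAt_ext_coord_change (I := 𝓡 n) (n := ∞) x' x (y := extChartAt (𝓡 n) x z)
      (by
        rw [PartialEquiv.trans_source, PartialEquiv.symm_source]
        refine ⟨(extChartAt (𝓡 n) x).map_source hx, ?_⟩
        rwa [mem_preimage, (extChartAt (𝓡 n) x).left_inv hx])
    rw [ModelWithCorners.range_eq_univ, contDiffWithinAt_univ] at h
    exact h.of_le (by norm_cast)
  obtain ⟨K, t, ht, hK⟩ := hτ.exists_lipschitzOnWith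
  refine ⟨K ^ n, extChartAt (𝓡 n) x ⁻¹' t ∩ (extChartAt (𝓡 n) x).source, Filter.inter_mem
    ((continuousAt_extChartAt' hx).preimage_mem_nhds ht) (extChartAt_source_mem_nhds' hx),
    fun A hA ↦ ?_⟩
  have h1 : extChartAt (𝓡 n) x' '' A = τ '' (extChartAt (𝓡 n) x '' A) := by
    rw [image_image]
    refine image_congr fun a ha ↦ ?_
    simp only [τ, Function.comp_apply, (extChartAt (𝓡 n) x).left_inv (hA ha).2]
  rw [h1]
  push_cast
  refine volume_image_le_of_lipschitzOnWith (hK.mono ?_)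
  rintro _ ⟨a, ha, rfl⟩
  exact (hA ha).1

theorem linearIndependent_coordVector (x : M) {y : EuclideanSpace ℝ (Fin n)}
    (hy : y ∈ (extChartAt (𝓡 n) x).target) : LinearIndependent ℝ (coordVector x y) := by
  have : IsManifold (𝓡 n) 1 M := .of_le (n := ∞) (by norm_cast)
  have h := isInvertible_mfderivWithin_extChartAt_symm hy
  rw [ModelWithCorners.range_eq_univ, mfderivWithin_univ] at h
  have hb := (EuclideanSpace.basisFun (Fin n) ℝ).toBasis.linearIndependent
  have h2 := hb.map' (mfderiv 𝓘(ℝ, EuclideanSpace ℝ (Fin n)) (𝓡 n)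
    (extChartAt (𝓡 n) x).symm y).toLinearMap (LinearMap.ker_eq_bot.2 h.injective)
  have h3 : coordVector x y = (mfderiv 𝓘(ℝ, EuclideanSpace ℝ (Fin n)) (𝓡 n)
      (extChartAt (𝓡 n) x).symm y).toLinearMap ∘ (EuclideanSpace.basisFun (Fin n) ℝ).toBasis := by
    ext1 i
    have hi : EuclideanSpace.single i (1 : ℝ) = (EuclideanSpace.basisFun (Fin n) ℝ).toBasis i := by
      simp
    exact congrArg (mfderiv 𝓘(ℝ, EuclideanSpace ℝ (Fin n)) (𝓡 n) (extChartAt (𝓡 n) x).symm y) hi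
  rw [h3]
  exact h2

variable [RiemannianBundle (fun x : M ↦ TangentSpace (𝓡 n) x)]

theorem metricMatrix_det_pos (x : M) {y : EuclideanSpace ℝ (Fin n)}
    (hy : y ∈ (extChartAt (𝓡 n) x).target) : 0 < (metricMatrix x y).det := by
  have h : LinearIndependent ℝ (coordVector x y) := linearIndependent_coordVector x hy
  have h2 := Matrix.posDef_gram_of_linearIndependent (𝕜 := ℝ)
    (E := TangentSpace (𝓡 n) ((extChartAt (𝓡 n) x).symm y)) h
  exact h2.det_pos

variable [IsContMDiffRiemannianBundle (𝓡 n) ∞ (EuclideanSpace ℝ (Fin n))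
  (fun x : M ↦ TangentSpace (𝓡 n) x)]

theorem isContinuousRiemannianBundle_tangentSpace :
    IsContinuousRiemannianBundle (EuclideanSpace ℝ (Fin n))
      (fun x : M ↦ TangentSpace (𝓡 n) x) := by
  obtain ⟨g, hg, h⟩ := IsContMDiffRiemannianBundle.exists_contMDiff (IB := 𝓡 n) (n := ∞)
    (F := EuclideanSpace ℝ (Fin n)) (E := fun x : M ↦ TangentSpace (𝓡 n) x)
  exact ⟨g, hg.continuous, h⟩

/-- The coordinate fields are images of constant fields under the tangent map of the inverse chart,
so they are continuous, and the metric is continuous. -/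
theorem continuousOn_metricMatrix_det (x : M) :
    ContinuousOn (fun y ↦ (metricMatrix x y).det) (extChartAt (𝓡 n) x).target := by
  have := isContinuousRiemannianBundle_tangentSpace (n := n) (M := M)
  have ho : IsOpen (extChartAt (𝓡 n) x).target := isOpen_extChartAt_target x
  have hv (i : Fin n) : ContinuousOn
      (fun y ↦ (⟨(extChartAt (𝓡 n) x).symm y, coordVector x y i⟩ : TangentBundle (𝓡 n) M))
      (extChartAt (𝓡 n) x).target := by
    have h := (contMDiffOn_extChartAt_symm (I := 𝓡 n) (n := ∞) x).continuousOn_tangentMapWithin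
      (by norm_cast) ho.uniqueMDiffOn
    have hc : Continuous (fun y ↦ (⟨y, EuclideanSpace.single i (1 : ℝ)⟩ :
        TangentBundle 𝓘(ℝ, EuclideanSpace ℝ (Fin n)) (EuclideanSpace ℝ (Fin n)))) :=
      (contMDiff_vectorSpace_iff_contDiff (n := 0).2 contDiff_const).continuous
    refine (h.comp hc.continuousOn fun y hy ↦ hy).congr fun y hy ↦ ?_
    simp only [Function.comp_apply, tangentMapWithin, coordVector]
    rw [mfderivWithin_of_isOpen ho hy]
  have hm : ContinuousOn (fun y ↦ metricMatrix x y) (extChartAt (𝓡 n) x).target := by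
    refine continuousOn_pi.2 fun i ↦ continuousOn_pi.2 fun j ↦ ?_
    exact ContinuousOn.inner_bundle (hv i) (hv j)
  exact Continuous.comp_continuousOn (continuous_id.matrix_det) hm

end Charts

/-! ### Comparison of Riemannian and coordinate volume -/

section Volume

variable {n : ℕ} {M : Type*} [TopologicalSpace M] [ChartedSpace (EuclideanSpace ℝ (Fin n)) M]

theorem tsupport_chartPartition_subset [T2Space M] [SigmaCompactSpace M]
    [IsManifold (𝓡 n) ∞ M] (x : M) :
    tsupport (chartPartition n M x) ⊆ (extChartAt (𝓡 n) x).source := by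
  rw [extChartAt_source]
  exact (SmoothPartitionOfUnity.exists_isSubordinate_chartAt_source (𝓡 n) M).choose_spec x

variable [MeasurableSpace M]

theorem measurableSet_image_extChartAt [BorelSpace M] {x : M} {A : Set M} (hA : MeasurableSet A)
    (hAx : A ⊆ (extChartAt (𝓡 n) x).source) : MeasurableSet (extChartAt (𝓡 n) x '' A) := by
  have ht : MeasurableSet (extChartAt (𝓡 n) x).target := (isOpen_extChartAt_target x).measurableSet
  have hc := (continuousOn_extChartAt_symm (I := 𝓡 n) x).domRestrict.measurable hA
  have := MeasurableSet.subtype_image ht hc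
  rw [(extChartAt (𝓡 n) x).image_eq_target_inter_inv_preimage hAx]
  convert this using 1
  rw [domRestrict_eq, preimage_comp, Subtype.image_preimage_coe]

variable [RiemannianBundle (fun x : M ↦ TangentSpace (𝓡 n) x)]

theorem riemVolume_apply [T2Space M] [SigmaCompactSpace M] [IsManifold (𝓡 n) ∞ M] {A : Set M}
    (hA : MeasurableSet A) :
    riemVolume n M A =
      ∑' x : M, ∫⁻ p in A, ENNReal.ofReal (chartPartition n M x p) ∂(chartVolume (n := n) x) := by
  rw [riemVolume, Measure.sum_apply _ hA]
  exact tsum_congr fun x ↦ withDensity_apply _ hA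

variable [BorelSpace M]

theorem chartVolume_apply {x : M} {A : Set M} (hA : MeasurableSet A)
    (hAx : A ⊆ (extChartAt (𝓡 n) x).source) :
    chartVolume (n := n) x A = ∫⁻ y in extChartAt (𝓡 n) x '' A, ENNReal.ofReal √(metricMatrix x y).det := by
  have ht : MeasurableSet (extChartAt (𝓡 n) x).target := (isOpen_extChartAt_target x).measurableSet
  -- The inverse chart is controlled only on its target; a.e. measurability there is what keeps
  -- `Measure.map` from being the default value `0`.
  have hm : AEMeasurable (extChartAt (𝓡 n) x).symm
      ((volume.restrict (extChartAt (𝓡 n) x).target).withDensity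
        (fun y ↦ ENNReal.ofReal (√(metricMatrix x y).det))) :=
    ((continuousOn_extChartAt_symm x).aemeasurable ht).mono_ac (withDensity_absolutelyContinuous _ _)
  rw [chartVolume, Measure.map_apply_of_aemeasurable hm hA, withDensity_apply',
    Measure.restrict_restrict' ht, (extChartAt (𝓡 n) x).image_eq_target_inter_inv_preimage hAx,
    inter_comm]

variable [IsManifold (𝓡 n) ∞ M] [IsContMDiffRiemannianBundle (𝓡 n) ∞ (EuclideanSpace ℝ (Fin n))
  (fun x : M ↦ TangentSpace (𝓡 n) x)]

/-- Near every point of the chart domain, the measure `√(det gᵢⱼ) dy` is comparable to `dy`. -/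
theorem exists_chartVolume_comparable {x z : M} (hz : z ∈ (extChartAt (𝓡 n) x).source) :
    ∃ c C : ℝ≥0, 0 < c ∧ ∃ U ∈ 𝓝 z, ∀ A ⊆ U, MeasurableSet A →
      (c : ℝ≥0∞) * volume (extChartAt (𝓡 n) x '' A) ≤ chartVolume (n := n) x A ∧
      chartVolume (n := n) x A ≤ (C : ℝ≥0∞) * volume (extChartAt (𝓡 n) x '' A) := by
  have hy := (extChartAt (𝓡 n) x).map_source hz
  have hc : ContinuousAt (fun y ↦ √(metricMatrix x y).det) (extChartAt (𝓡 n) x z) :=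
    Real.continuous_sqrt.continuousAt.comp
      ((continuousOn_metricMatrix_det x).continuousAt (extChartAt_target_mem_nhds' hy))
  set d := √(metricMatrix x (extChartAt (𝓡 n) x z)).det
  have hd : 0 < d := Real.sqrt_pos.2 (metricMatrix_det_pos x hy)
  have hev : ∀ᶠ y in 𝓝 (extChartAt (𝓡 n) x z),
      d / 2 < √(metricMatrix x y).det ∧ √(metricMatrix x y).det < 2 * d :=
    (hc.eventually_const_lt (half_lt_self hd)).and (hc.eventually_lt_const (by linarith))
  refine ⟨(d / 2).toNNReal, (2 * d).toNNReal, by simpa using hd, _, Filter.inter_mem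
    ((continuousAt_extChartAt' hz).preimage_mem_nhds hev) (extChartAt_source_mem_nhds' hz),
    fun A hA hAm ↦ ?_⟩
  have hAx : A ⊆ (extChartAt (𝓡 n) x).source := fun a ha ↦ (hA ha).2
  have him := measurableSet_image_extChartAt hAm hAx
  rw [chartVolume_apply hAm hAx, ← setLIntegral_const, ← setLIntegral_const]
  constructor
  · refine setLIntegral_mono' him ?_
    rintro _ ⟨a, ha, rfl⟩
    exact ENNReal.ofReal_le_ofReal (hA ha).1.1.le
  · refine setLIntegral_mono' him ?_
    rintro _ ⟨a, ha, rfl⟩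
    exact ENNReal.ofReal_le_ofReal (hA ha).1.2.le

variable [T2Space M] [SigmaCompactSpace M]

/-- A single term of the sum suffices: some weight `ρₓ` is positive at `z`, hence bounded below
nearby, and the charts at `x` and `z` have comparable volumes. -/
theorem exists_volume_le_riemVolume (z : M) :
    ∃ c : ℝ≥0, 0 < c ∧ ∃ U ∈ 𝓝 z, ∀ A ⊆ U, MeasurableSet A →
      (c : ℝ≥0∞) * volume (extChartAt (𝓡 n) z '' A) ≤ riemVolume n M A := by
  obtain ⟨x, hx⟩ := (chartPartition n M).exists_pos_of_mem (mem_univ z)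
  have hzx : z ∈ (extChartAt (𝓡 n) x).source :=
    tsupport_chartPartition_subset x (subset_tsupport _ hx.ne')
  obtain ⟨c, C, hc, U, hU, hcU⟩ := exists_chartVolume_comparable hzx
  obtain ⟨K, V, hV, hK⟩ := exists_volume_image_extChartAt_le hzx (mem_extChartAt_source z)
  set δ := chartPartition n M x z
  have hδ : ∀ᶠ p in 𝓝 z, δ / 2 < chartPartition n M x p :=
    (chartPartition n M x).contMDiff.continuous.continuousAt.eventually_const_lt (half_lt_self hx)
  -- `K + 1` replaces `K`, which may vanish.
  refine ⟨(δ / 2).toNNReal * c * (K + 1)⁻¹, by have := half_pos hx; positivity, _,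
    Filter.inter_mem hU (Filter.inter_mem hV hδ), fun A hA hAm ↦ ?_⟩
  have h1 := (hcU A (fun a ha ↦ (hA ha).1) hAm).1
  have h2 := hK A (fun a ha ↦ (hA ha).2.1)
  rw [riemVolume_apply hAm]
  refine le_trans ?_ (ENNReal.le_tsum x)
  have h3 : ((δ / 2).toNNReal : ℝ≥0∞) * chartVolume (n := n) x A ≤
      ∫⁻ p in A, ENNReal.ofReal (chartPartition n M x p) ∂(chartVolume (n := n) x) := by
    rw [← setLIntegral_const]
    exact setLIntegral_mono' hAm fun a ha ↦ ENNReal.ofReal_le_ofReal (hA ha).2.2.le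
  refine le_trans ?_ h3
  have h4 : (((K + 1)⁻¹ : ℝ≥0) : ℝ≥0∞) * volume (extChartAt (𝓡 n) z '' A) ≤
      volume (extChartAt (𝓡 n) x '' A) := by
    rw [ENNReal.coe_inv (by positivity), ENNReal.inv_mul_le_iff (by simp) (by simp)]
    refine h2.trans ?_
    gcongr
    simp
  calc _ = ((δ / 2).toNNReal : ℝ≥0∞) *
        (c * ((((K + 1)⁻¹ : ℝ≥0) : ℝ≥0∞) * volume (extChartAt (𝓡 n) z '' A))) := by
        push_cast; ring
    _ ≤ _ := by gcongr; exact le_trans (by gcongr) h1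

/-- By local finiteness only finitely many terms matter near `z`. Each either vanishes near `z` or
has `z` in its chart domain, where the weight is at most `1`. -/
theorem exists_riemVolume_le_volume (z : M) :
    ∃ C : ℝ≥0, ∃ U ∈ 𝓝 z, ∀ A ⊆ U, MeasurableSet A →
      riemVolume n M A ≤ (C : ℝ≥0∞) * volume (extChartAt (𝓡 n) z '' A) := by
  have key (x : M) : ∃ C : ℝ≥0, ∃ U ∈ 𝓝 z, ∀ A ⊆ U, MeasurableSet A →
      ∫⁻ p in A, ENNReal.ofReal (chartPartition n M x p) ∂(chartVolume (n := n) x) ≤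
        (C : ℝ≥0∞) * volume (extChartAt (𝓡 n) z '' A) := by
    by_cases hz : z ∈ tsupport (chartPartition n M x)
    · have hzx := tsupport_chartPartition_subset x hz
      obtain ⟨c, C, hc, U, hU, hcU⟩ := exists_chartVolume_comparable hzx
      obtain ⟨K, V, hV, hK⟩ := exists_volume_image_extChartAt_le (mem_extChartAt_source z) hzx
      refine ⟨C * K, _, Filter.inter_mem hU hV, fun A hA hAm ↦ ?_⟩
      calc _ ≤ ∫⁻ p in A, 1 ∂(chartVolume (n := n) x) := by
            refine lintegral_mono fun p ↦ ?_
            rw [← ENNReal.ofReal_one]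
            exact ENNReal.ofReal_le_ofReal ((chartPartition n M).le_one x p)
        _ = chartVolume (n := n) x A := by simp
        _ ≤ C * volume (extChartAt (𝓡 n) x '' A) := (hcU A (fun a ha ↦ (hA ha).1) hAm).2
        _ ≤ C * (K * volume (extChartAt (𝓡 n) z '' A)) := by
            gcongr; exact hK A (fun a ha ↦ (hA ha).2)
        _ = _ := by push_cast; ring
    · refine ⟨0, _, (isClosed_tsupport _).isOpen_compl.mem_nhds hz, fun A hA hAm ↦ ?_⟩
      rw [setLIntegral_congr_fun (g := fun _ ↦ 0) hAm fun p hp ↦ ?_]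
      · simp
      · simp [image_eq_zero_of_notMem_tsupport (hA hp)]
  choose C U hU hCU using key
  obtain ⟨V, hV, hfin⟩ := (chartPartition n M).locallyFinite z
  refine ⟨∑ x ∈ hfin.toFinset, C x, V ∩ ⋂ x ∈ hfin.toFinset, U x, Filter.inter_mem hV
    ((Filter.biInter_finset_mem _).2 fun x _ ↦ hU x), fun A hA hAm ↦ ?_⟩
  rw [riemVolume_apply hAm, tsum_eq_sum (s := hfin.toFinset)]
  · push_cast
    rw [Finset.sum_mul]
    refine Finset.sum_le_sum fun x hx ↦ hCU x A (fun a ha ↦ ?_) hAm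
    exact mem_iInter₂.1 (hA ha).2 x hx
  · intro x hx
    rw [setLIntegral_congr_fun (g := fun _ ↦ 0) hAm fun p hp ↦ ?_]
    · simp
    · have : chartPartition n M x p = 0 := by
        by_contra h
        exact hx (hfin.mem_toFinset.2 ⟨p, h, (hA hp).1⟩)
      simp [this]

end Volume

/-! ### Derivative and Lipschitz bounds for charts -/

section ChartEstimates

variable {n : ℕ} {M : Type*}

section Derivatives

variable [TopologicalSpace M] [ChartedSpace (EuclideanSpace ℝ (Fin n)) M]
  [IsManifold (𝓡 n) ∞ M] [RiemannianBundle (fun x : M ↦ TangentSpace (𝓡 n) x)]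
  [IsContMDiffRiemannianBundle (𝓡 n) ∞ (EuclideanSpace ℝ (Fin n))
    (fun x : M ↦ TangentSpace (𝓡 n) x)]

attribute [local instance] normedAddCommGroupTangentSpaceVectorSpace
  normedSpaceTangentSpaceVectorSpace

theorem exists_enorm_mfderiv_extChartAt_symm_le (z : M) :
    ∃ C > (0 : ℝ≥0), ∀ᶠ y in 𝓝 (extChartAt (𝓡 n) z z), ∀ v : EuclideanSpace ℝ (Fin n),
      ‖mfderiv 𝓘(ℝ, EuclideanSpace ℝ (Fin n)) (𝓡 n) (extChartAt (𝓡 n) z).symm y v‖ₑ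
        ≤ C * ‖v‖ₑ := by
  have := isContinuousRiemannianBundle_tangentSpace (n := n) (M := M)
  obtain ⟨C, hC, h⟩ := eventually_enorm_mfderivWithin_symm_extChartAt_lt (𝓡 n) z
  refine ⟨C, hC, ?_⟩
  rw [ModelWithCorners.range_eq_univ, nhdsWithin_univ] at h
  filter_upwards [h] with y hy v
  rw [mfderivWithin_univ] at hy
  refine (ContinuousLinearMap.le_opENorm _ _).trans ?_
  gcongr
  · exact hy.le
  · exact le_rfl

theorem exists_norm_mfderiv_extChartAt_le (z : M) :
    ∃ C > (0 : ℝ), ∀ᶠ q in 𝓝 z, ∀ v : TangentSpace (𝓡 n) q,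
      @norm (EuclideanSpace ℝ (Fin n)) _ (mfderiv (𝓡 n) 𝓘(ℝ, EuclideanSpace ℝ (Fin n))
        (extChartAt (𝓡 n) z) q v) ≤ C * ‖v‖ := by
  have := isContinuousRiemannianBundle_tangentSpace (n := n) (M := M)
  obtain ⟨C, hC, h⟩ := eventually_norm_mfderiv_extChartAt_lt (𝓡 n) z
  refine ⟨C, hC, ?_⟩
  filter_upwards [h] with q hq v
  refine (ContinuousLinearMap.le_opNorm _ _).trans ?_
  gcongr
  exact hq.le

end Derivatives

variable [MetricSpace M] [ChartedSpace (EuclideanSpace ℝ (Fin n)) M]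
  [IsManifold (𝓡 n) ∞ M] [RiemannianBundle (fun x : M ↦ TangentSpace (𝓡 n) x)]
  [IsContMDiffRiemannianBundle (𝓡 n) ∞ (EuclideanSpace ℝ (Fin n))
    (fun x : M ↦ TangentSpace (𝓡 n) x)] [IsRiemannianManifold (𝓡 n) M]

/-- The inverse of a chart is Lipschitz near the center of the chart. -/
theorem exists_lipschitzOnWith_extChartAt_symm (z : M) :
    ∃ K > (0 : ℝ≥0), ∃ R > 0,
      LipschitzOnWith K (extChartAt (𝓡 n) z).symm (Metric.ball (extChartAt (𝓡 n) z z) R) := by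
  obtain ⟨C, hC, h⟩ := exists_enorm_mfderiv_extChartAt_symm_le (n := n) z
  obtain ⟨R, hR, hball⟩ := Metric.mem_nhds_iff.1
    (Filter.inter_mem (extChartAt_target_mem_nhds (I := 𝓡 n) z) h)
  refine ⟨C, hC, R, hR, fun y hy y' hy' ↦ ?_⟩
  -- The Riemannian distance is at most the length of the image of the coordinate segment, which
  -- stays in the convex ball where the derivative is bounded.
  let η := ContinuousAffineMap.lineMap (R := ℝ) y y'
  set γ := (extChartAt (𝓡 n) z).symm ∘ η
  have hη : ∀ t ∈ Icc (0 : ℝ) 1, η t ∈ Metric.ball (extChartAt (𝓡 n) z z) R := by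
    intro t ht
    refine (convex_ball _ _).segment_subset hy hy' ?_
    rw [segment_eq_image_lineMap]
    exact ⟨t, ht, rfl⟩
  have η_smooth : ContMDiffOn 𝓘(ℝ, ℝ) 𝓘(ℝ, EuclideanSpace ℝ (Fin n)) 1 η (Icc 0 1) := by
    apply ContMDiff.contMDiffOn
    rw [contMDiff_iff_contDiff]
    exact ContinuousAffineMap.contDiff _
  have hsymm := contMDiffOn_extChartAt_symm (I := 𝓡 n) (n := 1) z
  have hle : edist ((extChartAt (𝓡 n) z).symm y) ((extChartAt (𝓡 n) z).symm y') ≤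
      pathELength (𝓡 n) γ 0 1 := by
    rw [IsRiemannianManifold.out (I := 𝓡 n)]
    apply riemannianEDist_le_pathELength _ _ _ zero_le_one
    · exact hsymm.comp η_smooth fun t ht ↦ (hball (hη t ht)).1
    · simp [γ, η, ContinuousAffineMap.coe_lineMap_eq]
    · simp [γ, η, ContinuousAffineMap.coe_lineMap_eq]
  refine hle.trans ?_
  rw [← lintegral_fderiv_lineMap_eq_edist, pathELength_eq_lintegral_mfderivWithin_Icc,
    ← lintegral_const_mul' _ _ ENNReal.coe_ne_top]
  refine setLIntegral_mono' measurableSet_Icc (fun t ht ↦ ?_)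
  have hd : mfderivWithin 𝓘(ℝ, ℝ) (𝓡 n) γ (Icc 0 1) t =
      (mfderiv 𝓘(ℝ, EuclideanSpace ℝ (Fin n)) (𝓡 n) (extChartAt (𝓡 n) z).symm (η t)) ∘L
        (mfderivWithin 𝓘(ℝ, ℝ) 𝓘(ℝ, EuclideanSpace ℝ (Fin n)) η (Icc 0 1) t) := by
    apply mfderiv_comp_mfderivWithin
    · exact (hsymm.contMDiffAt (extChartAt_target_mem_nhds' (hball (hη t ht)).1)).mdifferentiableAt
        one_ne_zero
    · exact η_smooth.mdifferentiableOn one_ne_zero t ht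
    · rw [uniqueMDiffWithinAt_iff_uniqueDiffWithinAt]
      exact uniqueDiffOn_Icc zero_lt_one t ht
  have hd1 := DFunLike.congr_fun hd 1
  rw [hd1]
  refine ((hball (hη t ht)).2 _).trans_eq ?_
  rw [mfderivWithin_eq_fderivWithin]
  rfl

end ChartEstimates

/-! ### Transplanting functions from coordinates to the manifold -/

section ChartPullback

variable {n : ℕ} {M : Type*} [TopologicalSpace M] [ChartedSpace (EuclideanSpace ℝ (Fin n)) M]

/-- The function `ψ` of the coordinates of the chart around `z`, extended by zero outside the chart
domain. -/
noncomputable def chartPullback (z : M) (ψ : EuclideanSpace ℝ (Fin n) → ℝ) : M → ℝ :=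
  (extChartAt (𝓡 n) z).source.indicator (ψ ∘ extChartAt (𝓡 n) z)

variable {z : M} {ψ : EuclideanSpace ℝ (Fin n) → ℝ} {T : Set (EuclideanSpace ℝ (Fin n))}

theorem chartPullback_eventuallyEq {q : M} (hq : q ∈ (extChartAt (𝓡 n) z).source) :
    chartPullback z ψ =ᶠ[𝓝 q] ψ ∘ extChartAt (𝓡 n) z := by
  filter_upwards [extChartAt_source_mem_nhds' hq] with p hp
  rw [chartPullback, indicator_of_mem hp]

/-- The image of `T` is compact, hence closed in `M`, so taking the closure of the support adds no
points at the edge of the chart domain. -/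
theorem tsupport_chartPullback_subset [T2Space M] (hT : IsCompact T)
    (hTz : T ⊆ (extChartAt (𝓡 n) z).target) (hψ : Function.support ψ ⊆ T) :
    tsupport (chartPullback z ψ) ⊆ (extChartAt (𝓡 n) z).symm '' T := by
  have hc : IsCompact ((extChartAt (𝓡 n) z).symm '' T) :=
    hT.image_of_continuousOn ((continuousOn_extChartAt_symm z).mono hTz)
  refine closure_minimal (fun q hq ↦ ?_) hc.isClosed
  have hqz : q ∈ (extChartAt (𝓡 n) z).source := by
    by_contra h
    exact hq (indicator_of_notMem h _)
  have hq' : ψ (extChartAt (𝓡 n) z q) ≠ 0 := by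
    rwa [Function.mem_support, chartPullback, indicator_of_mem hqz] at hq
  exact ⟨_, hψ hq', (extChartAt (𝓡 n) z).left_inv hqz⟩

theorem contMDiff_chartPullback [T2Space M] [IsManifold (𝓡 n) ∞ M] (hT : IsCompact T)
    (hTz : T ⊆ (extChartAt (𝓡 n) z).target) (hψ : Function.support ψ ⊆ T)
    (hψ' : ContDiff ℝ ∞ ψ) : ContMDiff (𝓡 n) 𝓘(ℝ, ℝ) ∞ (chartPullback z ψ) := by
  refine contMDiff_of_tsupport fun q hq ↦ ?_
  obtain ⟨y, hy, rfl⟩ := tsupport_chartPullback_subset hT hTz hψ hq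
  have hq := (extChartAt (𝓡 n) z).map_target (hTz hy)
  refine ContMDiffAt.congr_of_eventuallyEq ?_ (chartPullback_eventuallyEq hq)
  exact hψ'.contMDiff.contMDiffAt.comp _
    (contMDiffAt_extChartAt' (by rwa [extChartAt_source] at hq))

variable [RiemannianBundle (fun x : M ↦ TangentSpace (𝓡 n) x)]

theorem norm_riemGradient_le {f : M → ℝ} {q : M} {B : ℝ} (hB : 0 ≤ B)
    (h : ∀ v : TangentSpace (𝓡 n) q, |differential f q v| ≤ B * ‖v‖) :
    ‖riemGradient (n := n) f q‖ ≤ B := by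
  rw [riemGradient, LinearIsometryEquiv.norm_map]
  exact ContinuousLinearMap.opNorm_le_bound _ hB h

theorem riemGradient_eq_zero_of_notMem_tsupport {f : M → ℝ} {q : M} (hq : q ∉ tsupport f) :
    riemGradient (n := n) f q = 0 := by
  have h : f =ᶠ[𝓝 q] fun _ ↦ (0 : ℝ) := notMem_tsupport_iff_eventuallyEq.1 hq
  rw [riemGradient, differential, h.mfderiv_eq, mfderiv_const]
  exact map_zero _

theorem norm_riemGradient_chartPullback_le [IsManifold (𝓡 n) ∞ M] {q : M} {B L : ℝ} (hB : 0 ≤ B)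
    (hL : 0 ≤ L)
    (hq : q ∈ (extChartAt (𝓡 n) z).source) (hψ : DifferentiableAt ℝ ψ (extChartAt (𝓡 n) z q))
    (hψB : ‖fderiv ℝ ψ (extChartAt (𝓡 n) z q)‖ ≤ B)
    (hz : ∀ v : TangentSpace (𝓡 n) q,
      @norm (EuclideanSpace ℝ (Fin n)) _ (mfderiv (𝓡 n) 𝓘(ℝ, EuclideanSpace ℝ (Fin n))
        (extChartAt (𝓡 n) z) q v) ≤ L * ‖v‖) :
    ‖riemGradient (n := n) (chartPullback z ψ) q‖ ≤ B * L := by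
  refine norm_riemGradient_le (by positivity) fun v ↦ ?_
  have h : differential (chartPullback z ψ) q v = fderiv ℝ ψ (extChartAt (𝓡 n) z q)
      (mfderiv (𝓡 n) 𝓘(ℝ, EuclideanSpace ℝ (Fin n)) (extChartAt (𝓡 n) z) q v) := by
    rw [differential, (chartPullback_eventuallyEq hq).mfderiv_eq,
      mfderiv_comp q hψ.mdifferentiableAt
        (mdifferentiableAt_extChartAt (by rwa [extChartAt_source] at hq)), mfderiv_eq_fderiv]
    rfl
  rw [h, mul_assoc]
  exact (ContinuousLinearMap.le_opNorm (fderiv ℝ ψ (extChartAt (𝓡 n) z q)) _).trans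
    (mul_le_mul hψB (hz v) (norm_nonneg _) hB)

end ChartPullback

/-! ### Euclidean bump functions -/

section Bump

/-- There are bump functions on the balls of `ℝⁿ` whose gradient is at most a constant divided by
the radius. -/
theorem exists_bump_fderiv_le (n : ℕ) : ∃ B ≥ (0 : ℝ), ∀ (c : EuclideanSpace ℝ (Fin n)) (s : ℝ),
    0 < s → ∃ ψ : EuclideanSpace ℝ (Fin n) → ℝ, ContDiff ℝ ∞ ψ ∧
      Function.support ψ ⊆ Metric.closedBall c s ∧ (∀ y ∈ Metric.closedBall c (s / 2), ψ y = 1) ∧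
      ∀ y, ‖fderiv ℝ ψ y‖ ≤ B / s := by
  -- One fixed bump is translated and rescaled; the chain rule produces the factor `1 / s`.
  let χ : ContDiffBump (0 : EuclideanSpace ℝ (Fin n)) := ⟨1 / 2, 1, by norm_num, by norm_num⟩
  obtain ⟨B, hB⟩ := (χ.hasCompactSupport.fderiv (𝕜 := ℝ)).exists_bound_of_continuous
    ((χ.contDiff (n := 1)).continuous_fderiv one_ne_zero)
  have hB0 : 0 ≤ B := (norm_nonneg _).trans (hB 0)
  refine ⟨B, hB0, fun c s hs ↦ ⟨fun y ↦ χ (s⁻¹ • (y - c)), ?_, fun y hy ↦ ?_, fun y hy ↦ ?_,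
    fun y ↦ ?_⟩⟩
  · exact χ.contDiff.comp ((contDiff_id.sub contDiff_const).const_smul s⁻¹)
  · have : s⁻¹ • (y - c) ∈ Metric.ball 0 χ.rOut := by
      rw [← χ.support_eq]; exact hy
    rw [mem_ball_zero_iff, norm_smul, norm_inv, Real.norm_of_nonneg hs.le, inv_mul_lt_iff₀ hs,
      show χ.rOut = 1 from rfl, mul_one] at this
    rw [mem_closedBall_iff_norm]
    exact this.le
  · refine χ.one_of_mem_closedBall ?_
    rw [mem_closedBall_zero_iff, norm_smul, norm_inv, Real.norm_of_nonneg hs.le,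
      inv_mul_le_iff₀ hs, show χ.rIn = 1 / 2 from rfl]
    rw [mem_closedBall_iff_norm] at hy
    linarith
  · have h1 : HasFDerivAt (fun y : EuclideanSpace ℝ (Fin n) ↦ s⁻¹ • (y - c))
        (s⁻¹ • ContinuousLinearMap.id ℝ (EuclideanSpace ℝ (Fin n))) y :=
      ((hasFDerivAt_id y).sub_const c).const_smul s⁻¹
    have h2 : DifferentiableAt ℝ χ (s⁻¹ • (y - c)) :=
      (χ.contDiff (n := 1)).differentiable one_ne_zero _
    have h3 := h2.hasFDerivAt.comp y h1
    rw [Function.comp_def] at h3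
    rw [h3.fderiv, ContinuousLinearMap.comp_smul,
      ContinuousLinearMap.comp_id, norm_smul, norm_inv, Real.norm_of_nonneg hs.le, div_eq_inv_mul]
    gcongr
    exact hB _

end Bump

/-- A ball of radius larger than the diameter is the whole space. -/
theorem le_diam_of_ball_subset {X : Type*} [MetricSpace X] [CompactSpace X] {Ω : Set X}
    (hΩ : Ω ≠ univ) {p : X} {r : ℝ} (hball : Metric.ball p r ⊆ Ω) :
    r ≤ Metric.diam (univ : Set X) := by
  by_contra! hlt
  refine hΩ (univ_subset_iff.1 fun q _ ↦ hball ?_)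
  exact (Metric.dist_le_diam_of_mem isCompact_univ.isBounded (mem_univ q) (mem_univ p)).trans_lt
    hlt

/-! ### Bounds for the first Dirichlet eigenvalue -/

section Eigenvalue

variable {n : ℕ} {M : Type*}

section Basic

variable [TopologicalSpace M] [ChartedSpace (EuclideanSpace ℝ (Fin n)) M]
  [RiemannianBundle (fun x : M ↦ TangentSpace (𝓡 n) x)]
  [MeasurableSpace M] [T2Space M] [SigmaCompactSpace M] [IsManifold (𝓡 n) ∞ M]

theorem lambdaOne_anti {Ω Ω' : Set M} (h : Ω ⊆ Ω') : lambdaOne n Ω' ≤ lambdaOne n Ω :=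
  le_iInf fun f ↦ le_iInf fun hf ↦ le_iInf fun hf0 ↦
    iInf_le_of_le f (iInf_le_of_le ⟨hf.1, hf.2.1, hf.2.2.trans h⟩ (iInf_le _ hf0))

theorem lambdaOne_univ [CompactSpace M] [Nonempty M] : lambdaOne n (univ : Set M) = 0 := by
  have hg (p : M) : riemGradient (n := n) (fun _ : M ↦ (1 : ℝ)) p = 0 := by
    rw [riemGradient, differential, mfderiv_const]
    exact map_zero _
  have hne : (fun _ : M ↦ (1 : ℝ)) ≠ 0 := fun h ↦
    one_ne_zero (congrFun h (Classical.arbitrary M))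
  refine le_antisymm (iInf_le_of_le (fun _ ↦ 1) (iInf_le_of_le
    ⟨contMDiff_const, HasCompactSupport.of_compactSpace _, subset_univ _⟩
    (iInf_le_of_le hne ?_))) zero_le
  -- `0 / a = 0` in `ℝ≥0∞` for every `a`, so the total volume plays no role.
  simp [rayleigh, hg]

/-- An upper bound for the Rayleigh quotient of a function that is supported in `S`, is equal to `1`
on `S'`, and has gradient at most `G`. -/
theorem rayleigh_le {f : M → ℝ} {S S' : Set M} (hS : MeasurableSet S) (hS' : MeasurableSet S')
    (hf : tsupport f ⊆ S) (hf1 : ∀ q ∈ S', f q = 1) {G : ℝ≥0∞}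
    (hG : ∀ q ∈ S, ‖riemGradient (n := n) f q‖ₑ ≤ G) {D : ℝ≥0∞}
    (hD : G ^ 2 * riemVolume n M S ≤ D * riemVolume n M S') : rayleigh n f ≤ D := by
  refine ENNReal.div_le_of_le_mul ?_
  calc ∫⁻ p, ‖riemGradient (n := n) f p‖ₑ ^ 2 ∂(riemVolume n M)
      ≤ ∫⁻ p, S.indicator (fun _ ↦ G ^ 2) p ∂(riemVolume n M) := by
        refine lintegral_mono fun p ↦ ?_
        by_cases hp : p ∈ S
        · rw [indicator_of_mem hp]
          gcongr
          exact hG p hp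
        · rw [riemGradient_eq_zero_of_notMem_tsupport fun h ↦ hp (hf h)]
          simp
    _ = G ^ 2 * riemVolume n M S := lintegral_indicator_const hS _
    _ ≤ D * riemVolume n M S' := hD
    _ = D * ∫⁻ p in S', 1 ∂(riemVolume n M) := by simp
    _ ≤ D * ∫⁻ p in S', ‖f p‖ₑ ^ 2 ∂(riemVolume n M) := by
        gcongr 1
        exact setLIntegral_mono' hS' fun p hp ↦ by simp [hf1 p hp]
    _ ≤ D * ∫⁻ p, ‖f p‖ₑ ^ 2 ∂(riemVolume n M) := by
        gcongr 1
        exact setLIntegral_le_lintegral _ _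

end Basic

variable [MetricSpace M] [CompactSpace M] [ChartedSpace (EuclideanSpace ℝ (Fin n)) M]
  [IsManifold (𝓡 n) ∞ M] [RiemannianBundle (fun x : M ↦ TangentSpace (𝓡 n) x)]
  [IsContMDiffRiemannianBundle (𝓡 n) ∞ (EuclideanSpace ℝ (Fin n))
    (fun x : M ↦ TangentSpace (𝓡 n) x)] [IsRiemannianManifold (𝓡 n) M]
  [MeasurableSpace M] [BorelSpace M]

/-- Around every point, the first Dirichlet eigenvalue of a small ball of radius `r` is at most a
constant divided by `r²`. -/
theorem exists_lambdaOne_ball_le_nhds (z : M) : ∃ ε > (0 : ℝ), ∃ D ≥ (0 : ℝ), ∃ U ∈ 𝓝 z,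
    ∀ p ∈ U, ∀ r, 0 < r → r ≤ ε →
      lambdaOne n (Metric.ball p r) ≤ ENNReal.ofReal (D / r ^ 2) := by
  obtain ⟨B, hB, hbump⟩ := exists_bump_fderiv_le n
  obtain ⟨L, hL, hLz⟩ := exists_norm_mfderiv_extChartAt_le (n := n) z
  obtain ⟨c, hc, U, hU, hcU⟩ := exists_volume_le_riemVolume (n := n) z
  obtain ⟨C, V, hV, hCV⟩ := exists_riemVolume_le_volume (n := n) z
  obtain ⟨K, hK, R₀, hR₀, hlip⟩ := exists_lipschitzOnWith_extChartAt_symm (n := n) z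
  set e := extChartAt (𝓡 n) z
  have hsymm : e.symm ⁻¹' (U ∩ V ∩ {q | ∀ v : TangentSpace (𝓡 n) q,
      @norm (EuclideanSpace ℝ (Fin n)) _ (mfderiv (𝓡 n) 𝓘(ℝ, EuclideanSpace ℝ (Fin n))
        (extChartAt (𝓡 n) z) q v) ≤ L * ‖v‖}) ∈ 𝓝 (e z) := by
    refine (continuousAt_extChartAt_symm z).preimage_mem_nhds ?_
    rw [extChartAt_to_inv]
    exact Filter.inter_mem (Filter.inter_mem hU hV) hLz
  obtain ⟨R, hR, hball⟩ := Metric.mem_nhds_iff.1 (Filter.inter_mem hsymm (Filter.inter_mem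
    (extChartAt_target_mem_nhds (I := 𝓡 n) z) (Metric.ball_mem_nhds _ hR₀)))
  have hK' : (0 : ℝ) < K := hK
  have hc' : (0 : ℝ) < c := hc
  -- `r ≤ K * R / 2` gives `s ≤ R / 4`, so balls of radius `s` centered within `R / 2` of `e z` stay
  -- in the good ball of radius `R`. The constant is the squared gradient bound `(B * L * (2K) /
  -- r)²` times the volume ratio `C * 2ⁿ / c`, without its `1 / r²`.
  refine ⟨K * R / 2, by positivity, (B * L * (2 * K)) ^ 2 * C * 2 ^ n / c, by positivity,
    e ⁻¹' Metric.ball (e z) (R / 2) ∩ e.source, Filter.inter_mem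
    ((continuousAt_extChartAt z).preimage_mem_nhds (Metric.ball_mem_nhds _ (by positivity)))
    (extChartAt_source_mem_nhds z), ?_⟩
  rintro p ⟨hp, hpe⟩ r hr hrε
  set s : ℝ := r / (2 * K) with hs_def
  have hs : 0 < s := by positivity
  have hsR : s ≤ R / 4 := by
    rw [hs_def, div_le_iff₀ (by positivity)]
    linarith
  obtain ⟨ψ, hψ, hψs, hψ1, hψB⟩ := hbump (e p) s hs
  set T := Metric.closedBall (e p) s
  set T' := Metric.closedBall (e p) (s / 2)
  have hTT' : T' ⊆ T := Metric.closedBall_subset_closedBall (by linarith)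
  have hTR : T ⊆ Metric.ball (e z) R := by
    refine Metric.closedBall_subset_ball' ?_
    have : dist (e p) (e z) < R / 2 := hp
    linarith
  have hTe : T ⊆ e.target := fun y hy ↦ (hball (hTR hy)).2.1
  have hT : IsCompact T := isCompact_closedBall _ _
  have hT' : IsCompact T' := isCompact_closedBall _ _
  have hmeas {A : Set (EuclideanSpace ℝ (Fin n))} (hA : IsCompact A) (hAT : A ⊆ T) :
      MeasurableSet (e.symm '' A) :=
    (hA.image_of_continuousOn ((continuousOn_extChartAt_symm z).mono
      (hAT.trans hTe))).isClosed.measurableSet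
  have himage {A : Set (EuclideanSpace ℝ (Fin n))} (hAT : A ⊆ T) : e '' (e.symm '' A) = A := by
    rw [image_image]
    exact (image_congr fun y hy ↦ e.right_inv (hTe (hAT hy))).trans (image_id' A)
  have hts := tsupport_chartPullback_subset hT hTe hψs
  have hTball : e.symm '' T ⊆ Metric.ball p r := by
    rintro _ ⟨y, hy, rfl⟩
    have hpT : e p ∈ T := Metric.mem_closedBall_self hs.le
    have h1 := hlip.dist_le_mul y (hball (hTR hy)).2.2 (e p) (hball (hTR hpT)).2.2
    rw [e.left_inv hpe] at h1
    rw [Metric.mem_ball]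
    calc _ ≤ K * dist y (e p) := h1
      _ ≤ K * s := by gcongr; exact hy
      _ = r / 2 := by rw [hs_def]; field_simp
      _ < r := by linarith
  have hf1 : ∀ q ∈ e.symm '' T', chartPullback z ψ q = 1 := by
    rintro _ ⟨y, hy, rfl⟩
    have hye := hTe (hTT' hy)
    rw [chartPullback, indicator_of_mem (e.map_target hye), Function.comp_apply,
      e.right_inv hye, hψ1 y hy]
  have hf0 : chartPullback z ψ ≠ 0 := by
    intro h
    have := hf1 _ ⟨e p, Metric.mem_closedBall_self (by positivity), rfl⟩
    simp [h] at this
  refine iInf_le_of_le (chartPullback z ψ) (iInf_le_of_le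
    ⟨contMDiff_chartPullback hT hTe hψs hψ, HasCompactSupport.of_compactSpace _, hts.trans hTball⟩
    (iInf_le_of_le hf0 ?_))
  refine rayleigh_le (hmeas hT le_rfl) (hmeas hT' hTT') hts hf1 (G := ENNReal.ofReal (B / s * L))
    ?_ ?_
  · rintro _ ⟨y, hy, rfl⟩
    rw [← ofReal_norm]
    refine ENNReal.ofReal_le_ofReal (norm_riemGradient_chartPullback_le (by positivity) hL.le
      (e.map_target (hTe hy)) (hψ.differentiable (by simp) _) (hψB _) ?_)
    exact (hball (hTR hy)).1.2
  · have hup := hCV (e.symm '' T) (by rintro _ ⟨y, hy, rfl⟩; exact (hball (hTR hy)).1.1.2)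
      (hmeas hT le_rfl)
    have hlow := hcU (e.symm '' T')
      (by rintro _ ⟨y, hy, rfl⟩; exact (hball (hTR (hTT' hy))).1.1.1) (hmeas hT' hTT')
    rw [himage le_rfl] at hup
    rw [himage hTT'] at hlow
    -- Doubling is needed only for concentric Euclidean balls.
    have hvol : volume T = ENNReal.ofReal (2 ^ n) * volume T' := by
      have := Measure.addHaar_closedBall_mul volume (e p) (r := 2) (by norm_num) (s := s / 2)
        (by positivity)
      rw [mul_div_cancel₀ s two_ne_zero, finrank_euclideanSpace_fin] at this
      rw [this, Measure.addHaar_closedBall_center volume (e p)]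
    calc _ ≤ ENNReal.ofReal (B / s * L) ^ 2 * (C * (ENNReal.ofReal (2 ^ n) * volume T')) := by
          rw [← hvol]; gcongr
      _ = ENNReal.ofReal ((B * L * (2 * K)) ^ 2 * C * 2 ^ n / c / r ^ 2) * (c * volume T') := by
          rw [← ENNReal.ofReal_coe_nnreal (p := C), ← ENNReal.ofReal_coe_nnreal (p := c),
            ← ENNReal.ofReal_pow (by positivity), ← mul_assoc, ← mul_assoc, ← mul_assoc,
            ← ENNReal.ofReal_mul (by positivity), ← ENNReal.ofReal_mul (by positivity),
            ← ENNReal.ofReal_mul (by positivity)]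
          congr 2
          rw [hs_def]
          field_simp
      _ ≤ _ := by gcongr

/-- On a closed manifold, the first Dirichlet eigenvalue of a small ball of radius `r` is at most a
constant divided by `r²`. -/
theorem exists_lambdaOne_ball_le : ∃ ε > (0 : ℝ), ∃ D ≥ (0 : ℝ), ∀ (p : M) (r : ℝ), 0 < r → r ≤ ε →
    lambdaOne n (Metric.ball p r) ≤ ENNReal.ofReal (D / r ^ 2) := by
  have key : ∃ ε > (0 : ℝ), ∃ D ≥ (0 : ℝ), ∀ p ∈ (univ : Set M), ∀ r, 0 < r → r ≤ ε →
      lambdaOne n (Metric.ball p r) ≤ ENNReal.ofReal (D / r ^ 2) := by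
    -- Having some `ε` and `D` passes to subsets and to finite unions, taking the smaller `ε` and
    -- the larger `D`.
    refine isCompact_univ.induction_on (p := fun s ↦ ∃ ε > (0 : ℝ), ∃ D ≥ (0 : ℝ), ∀ p ∈ s,
      ∀ r, 0 < r → r ≤ ε → lambdaOne n (Metric.ball p r) ≤ ENNReal.ofReal (D / r ^ 2))
      ⟨1, one_pos, 0, le_rfl, by simp⟩ ?_ ?_ ?_
    · rintro s t hst ⟨ε, hε, D, hD, h⟩
      exact ⟨ε, hε, D, hD, fun p hp ↦ h p (hst hp)⟩
    · rintro s t ⟨ε, hε, D, hD, h⟩ ⟨ε', hε', D', hD', h'⟩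
      refine ⟨min ε ε', lt_min hε hε', max D D', le_max_of_le_left hD, ?_⟩
      rintro p (hp | hp) r hr hrε
      · refine (h p hp r hr (hrε.trans (min_le_left _ _))).trans (ENNReal.ofReal_le_ofReal ?_)
        gcongr
        exact le_max_left _ _
      · refine (h' p hp r hr (hrε.trans (min_le_right _ _))).trans (ENNReal.ofReal_le_ofReal ?_)
        gcongr
        exact le_max_right _ _
    · intro z _
      obtain ⟨ε, hε, D, hD, U, hU, h⟩ := exists_lambdaOne_ball_le_nhds (n := n) z
      exact ⟨U, mem_nhdsWithin_of_mem_nhds hU, ε, hε, D, hD, h⟩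
  simpa using key

/-- If `Ω ≠ M` contains a ball of radius `r`, then `λ₁(Ω) ≤ C / r²`. -/
theorem exists_lambdaOne_le_of_ball_subset : ∃ C : ℝ≥0, ∀ Ω : Set M, Ω ≠ univ → ∀ (p : M) (r : ℝ≥0),
    r ≠ 0 → Metric.ball p (r : ℝ) ⊆ Ω → lambdaOne n Ω ≤ (C : ℝ≥0∞) / (r : ℝ≥0∞) ^ 2 := by
  obtain ⟨ε, hε, D, hD, h⟩ := exists_lambdaOne_ball_le (n := n) (M := M)
  set d := Metric.diam (univ : Set M)
  have hd : 0 ≤ d := Metric.diam_nonneg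
  have hD' : 0 ≤ D * (1 + d / ε) ^ 2 := by positivity
  refine ⟨(D * (1 + d / ε) ^ 2).toNNReal, fun Ω hΩ p r hr hball ↦ ?_⟩
  have hr0 : (0 : ℝ) < r := by positivity
  have hrd : (r : ℝ) ≤ d := le_diam_of_ball_subset hΩ hball
  have hm : 0 < min (r : ℝ) ε := lt_min hr0 hε
  -- If `r ≤ ε` the factor is at least `1`; otherwise `r ≤ d = (d / ε) * ε`.
  have hrm : (r : ℝ) ≤ (1 + d / ε) * min (r : ℝ) ε := by
    rcases le_total (r : ℝ) ε with hle | hle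
    · rw [min_eq_left hle]
      have : 0 ≤ d / ε := by positivity
      nlinarith
    · rw [min_eq_right hle, add_mul, div_mul_cancel₀ d hε.ne']
      linarith
  calc lambdaOne n Ω ≤ lambdaOne n (Metric.ball p (min (r : ℝ) ε)) :=
        lambdaOne_anti ((Metric.ball_subset_ball (min_le_left _ _)).trans hball)
    _ ≤ ENNReal.ofReal (D / min (r : ℝ) ε ^ 2) := h p _ hm (min_le_right _ _)
    _ ≤ ENNReal.ofReal (D * (1 + d / ε) ^ 2 / (r : ℝ) ^ 2) := by
        refine ENNReal.ofReal_le_ofReal ?_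
        rw [div_le_div_iff₀ (by positivity) (by positivity), mul_assoc, ← mul_pow]
        gcongr
    _ = _ := by
        rw [ENNReal.ofReal_div_of_pos (by positivity), ENNReal.ofReal_pow hr0.le,
          ENNReal.ofReal_coe_nnreal]
        rfl


end Eigenvalue

end RiemGeom

/-- On a closed connected Riemannian manifold `M` there is a constant `C` such that
`λ₁(Ω) ≤ C / inrad(Ω)²` for every domain `Ω` in `M`. -/
theorem theorem3 {n : ℕ} {M : Type*} [MetricSpace M] [CompactSpace M] [ConnectedSpace M]
    [ChartedSpace (EuclideanSpace ℝ (Fin n)) M] [IsManifold (𝓡 n) ∞ M]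
    [RiemannianBundle (fun x : M ↦ TangentSpace (𝓡 n) x)]
    [IsContMDiffRiemannianBundle (𝓡 n) ∞ (EuclideanSpace ℝ (Fin n))
      (fun x : M ↦ TangentSpace (𝓡 n) x)]
    [IsRiemannianManifold (𝓡 n) M] [MeasurableSpace M] [BorelSpace M] :
    ∃ C : ℝ≥0, ∀ Ω : Set M, IsOpen Ω → IsConnected Ω →
      RiemGeom.lambdaOne n Ω ≤ (C : ℝ≥0∞) / RiemGeom.inrad Ω ^ 2 := by
  obtain ⟨C, hC⟩ := RiemGeom.exists_lambdaOne_le_of_ball_subset (n := n) (M := M)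
  refine ⟨4 * C, fun Ω hΩ hΩc ↦ ?_⟩
  rcases eq_or_ne Ω univ with rfl | hne
  · rw [RiemGeom.lambdaOne_univ]
    exact zero_le
  have hpos : RiemGeom.inrad Ω ≠ 0 := by
    obtain ⟨p, hp⟩ := hΩc.nonempty
    obtain ⟨r, hr, hball⟩ := Metric.isOpen_iff.1 hΩ p hp
    lift r to ℝ≥0 using hr.le
    have : (r : ℝ≥0∞) ≤ RiemGeom.inrad Ω := le_iSup_of_le p (le_iSup_of_le r
      (le_iSup_of_le hball le_rfl))
    have hr' : (0 : ℝ≥0∞) < r := by exact_mod_cast hr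
    exact (hr'.trans_le this).ne'
  have hfin : RiemGeom.inrad Ω ≠ ⊤ := by
    refine ne_top_of_le_ne_top (b := ENNReal.ofReal (Metric.diam (univ : Set M)))
      ENNReal.ofReal_ne_top (iSup_le fun p ↦ iSup_le fun r ↦ iSup_le fun hball ↦ ?_)
    rw [← ENNReal.ofReal_coe_nnreal]
    exact ENNReal.ofReal_le_ofReal (RiemGeom.le_diam_of_ball_subset hne hball)
  -- Half the inner radius is strictly below the supremum only because the latter is neither `0` nor
  -- `⊤`; some ball in `Ω` then has a larger radius than this half.
  have hlt := ENNReal.half_lt_self hpos hfin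
  conv_rhs at hlt => rw [RiemGeom.inrad]
  obtain ⟨p, hlt⟩ := lt_iSup_iff.1 hlt
  obtain ⟨r, hlt⟩ := lt_iSup_iff.1 hlt
  obtain ⟨hball, hlt⟩ := lt_iSup_iff.1 hlt
  have hr : r ≠ 0 := by
    rintro rfl
    simp at hlt
  have h2 : RiemGeom.inrad Ω ≤ 2 * r := by
    rw [mul_comm, ← ENNReal.div_le_iff two_ne_zero ENNReal.ofNat_ne_top]
    exact hlt.le
  calc RiemGeom.lambdaOne n Ω ≤ (C : ℝ≥0∞) / (r : ℝ≥0∞) ^ 2 := hC Ω hne p r hr hball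
    _ = (4 * C) / (2 * r) ^ 2 := by
        rw [mul_pow, show (2 : ℝ≥0∞) ^ 2 = 4 by norm_num,
          ENNReal.mul_div_mul_left _ _ (by norm_num) (by norm_num)]
    _ ≤ (4 * C) / RiemGeom.inrad Ω ^ 2 := by gcongr
    _ = _ := by push_cast; rfl
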